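/- Let $\mathfrak g$ be a finite-dimensional complex Lie algebra with $\mathfrak g=\mathfrak g_0+\mathfrak m$, where $\mathfrak m$ is an abelian ideal and $\mathfrak g_0$ a subalgebra of $\mathfrak g$, and let $E=\mathbb C^n$. A formal vector field on $E$ is an expression $S=\sum_{i=1}^n S_i\,\partial/\partial z_i$ with $S_i\in\mathbb C[[z_1,\dots,z_n]]$; it is called analytic if its power series converges in a neighbourhood of $0$, and $S^0\in E$ denotes its constant term. Let $T:X\mapsto T_X$ be a nonlinear analytic representation of $\mathfrak g$ in $E$, that is, a linear map from $\mathfrak g$ to the formal vector fields on $E$ such that $[T_X,T_Y]=T_{[X,Y]}$ for all $X,Y\in\mathfrak g$ and every $T_X$ is analytic. Assume that $T^0_X=0$ for $X\in\mathfrak g_0$ and $T^0_X\neq 0$ for $X\in\mathfrak m\setminus\{0\}$. Put $p=\dim\mathfrak m$. Then $p\le n$ and, with $q=n-p$, there is an analytic coordinate system $(x_1,\dots,x_p,y_1,\dots,y_q)$ of $E$ at the origin (a biholomorphic map from an open neighbourhood $U$ of $0$ in $E$ onto an open subset of $\mathbb C^p\times\mathbb C^q$, sending $0$ to $0$) and linear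 forms $a_1,\dots,a_p\in\mathfrak m^*$ such that, for all $X\in\mathfrak m$, the power series $T_X$ converges on $U$ and in these coordinates $$T_X=\sum_{i=1}^p a_i(X)\,\frac{\partial}{\partial x_i}\qquad\text{on } U .$$ -/

import Mathlib

/-- Formal vector fields `∑ᵢ Sᵢ(x₁,…,xₙ) ∂/∂xᵢ` on `ℂⁿ` (not necessarily vanishing at `0`), given
by their components, which are formal power series in `x₁,…,xₙ`. -/
abbrev FormalVectorField (n : ℕ) : Type := Fin n → MvPowerSeries (Fin n) ℂ

namespace FormalVectorField

/-- The Lie bracket of formal vector fields: the `i`-th component of `[S, T]` is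
`∑ⱼ (Sⱼ ∂Tᵢ/∂xⱼ - Tⱼ ∂Sᵢ/∂xⱼ)`. (It is not the pointwise commutator, which is zero.) -/
noncomputable def lieBracket {n : ℕ} (S T : FormalVectorField n) : FormalVectorField n :=
  fun i => ∑ j, (S j * MvPowerSeries.pderiv ℂ j (T i) - T j * MvPowerSeries.pderiv ℂ j (S i))

/-- The degree-zero part `S⁰ ∈ ℂⁿ` of a formal vector field, i.e. its value at the origin. -/
noncomputable def constantPart {n : ℕ} (S : FormalVectorField n) : Fin n → ℂ :=
  fun i => MvPowerSeries.constantCoeff (S i)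

/-- The power series `S` converges (absolutely) at the point `v ∈ ℂⁿ`, and its sum `S(v)` is the
vector `w ∈ ℂⁿ`. -/
def HasValueAt {n : ℕ} (S : FormalVectorField n) (v w : Fin n → ℂ) : Prop :=
  ∀ i, HasSum (fun α : Fin n →₀ ℕ => MvPowerSeries.coeff α (S i) * ∏ j, v j ^ α j) (w i)

/-- A formal vector field is analytic if its power series converges in a neighbourhood of the
origin. -/
def IsAnalytic {n : ℕ} (S : FormalVectorField n) : Prop :=
  ∀ᶠ v in nhds (0 : Fin n → ℂ), ∃ w, S.HasValueAt v w

end FormalVectorField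

/-- A linear map `X ↦ T_X` from a complex Lie algebra to the formal vector fields on `ℂⁿ` is a
nonlinear (formal) representation if `T_[X,Y] = [T_X, T_Y]`. -/
def IsNonlinearRepresentation {𝔤 : Type*} [LieRing 𝔤] [LieAlgebra ℂ 𝔤] {n : ℕ}
    (T : 𝔤 →ₗ[ℂ] FormalVectorField n) : Prop :=
  ∀ X Y : 𝔤, T ⁅X, Y⁆ = FormalVectorField.lieBracket (T X) (T Y)

/-- `φ = (x₁,…,x_p,y₁,…,y_q)` is an analytic coordinate system of `ℂⁿ` at the origin: a
biholomorphism from an open neighbourhood of `0` onto an open subset of `ℂᵖ × ℂ^q`, sending `0`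
to `0`. -/
structure IsAnalyticCoordinateSystem {n p q : ℕ}
    (φ : OpenPartialHomeomorph (Fin n → ℂ) ((Fin p → ℂ) × (Fin q → ℂ))) : Prop where
  zero_mem_source : 0 ∈ φ.source
  map_zero : φ 0 = 0
  analyticOnNhd : AnalyticOnNhd ℂ φ φ.source
  analyticOnNhd_symm : AnalyticOnNhd ℂ φ.symm φ.target

/-- In the coordinates `φ = (x₁,…,x_p,y₁,…,y_q)`, the formal vector field `S` is the
constant-coefficient field `∑ᵢ cᵢ ∂/∂xᵢ`: at every point `v` of the domain of `φ` the series `S`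
converges, and the differential of `φ` at `v` maps the tangent vector `S(v)` to `(c, 0)`. -/
def FormalVectorField.IsConstantIn {n p q : ℕ} (S : FormalVectorField n)
    (φ : OpenPartialHomeomorph (Fin n → ℂ) ((Fin p → ℂ) × (Fin q → ℂ))) (c : Fin p → ℂ) : Prop :=
  ∀ v ∈ φ.source, ∃ w, S.HasValueAt v w ∧ fderiv ℂ φ v w = (c, 0)

/-! Since `𝔪` is abelian, the fields `T_X` with `X ∈ 𝔪` commute, and for a basis of `𝔪` their values
at `0` are linearly independent. The result is the simultaneous straightening of commuting fields
`f₁, …, f_p`: let `Φ(x, z)` be the time-one position of the flow of `∑ xⱼ fⱼ` started at `z`;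
commutation gives `∂Φ/∂xₖ = fₖ(Φ)`. Restricting `z` to a complement of the span of the `fⱼ(0)`
yields a local biholomorphism whose inverse is the chart.

Analyticity of `Φ` comes from the implicit function theorem, applied to the integral equation of the
flow in the Banach space of paths (`PathSpace.exists_analytic_flow`). A convergent power series can
be evaluated in any commutative Banach algebra, in particular in `C([0,1], ℂ)`, so composition with
`fⱼ` is analytic on paths. The derivative in `xₖ` is found by checking that `t fₖ(u(t))` solves the
linearized equation (`PathSpace.fderiv_flowEquation_of_commute`). -/

open Filter Topology

/-! ### Evaluation of power series in commutative Banach algebras. -/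

namespace MvPowerSeries

/-- The power series `S` converges absolutely on the closed polydisc of radius `R`. -/
def AbsConverges {σ : Type*} (S : MvPowerSeries σ ℂ) (R : ℝ) : Prop :=
  Summable fun α : σ →₀ ℕ => ‖coeff α S‖ * R ^ α.degree

section BanachEval

variable {σ : Type*} [Fintype σ] {A : Type*} [NormedCommRing A] [NormedAlgebra ℂ A]

/-- The value of a power series at a tuple of elements of a commutative Banach algebra. -/
noncomputable def banachEval (S : MvPowerSeries σ ℂ) (u : σ → A) : A :=
  ∑' α : σ →₀ ℕ, coeff α S • ∏ j, u j ^ α j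

variable [NormOneClass A]

omit [NormedAlgebra ℂ A] in
theorem norm_prod_pow_le (u : σ → A) (α : σ →₀ ℕ) : ‖∏ j, u j ^ α j‖ ≤ ‖u‖ ^ α.degree := by
  rw [Finsupp.degree_eq_sum, ← Finset.prod_pow_eq_pow_sum]
  refine (Finset.norm_prod_le _ _).trans (Finset.prod_le_prod (fun _ _ => norm_nonneg _) ?_)
  exact fun j _ => (norm_pow_le _ _).trans (pow_le_pow_left₀ (norm_nonneg _) (norm_le_pi_norm u j) _)

omit [Fintype σ] in
theorem AbsConverges.mono {S : MvPowerSeries σ ℂ} {r R : ℝ} (hS : S.AbsConverges R) (hr : 0 ≤ r)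
    (h : r ≤ R) : S.AbsConverges r :=
  hS.of_nonneg_of_le (fun _ => by positivity) fun _ => by gcongr

theorem AbsConverges.summable_norm {S : MvPowerSeries σ ℂ} {R : ℝ} (hS : S.AbsConverges R)
    {u : σ → A} (hu : ‖u‖ ≤ R) : Summable fun α : σ →₀ ℕ => ‖coeff α S • ∏ j, u j ^ α j‖ :=
  hS.of_nonneg_of_le (fun _ => norm_nonneg _) fun α => by
    rw [norm_smul]
    gcongr
    exact (norm_prod_pow_le u α).trans (pow_le_pow_left₀ (norm_nonneg _) hu _)

theorem AbsConverges.hasSum [CompleteSpace A] {S : MvPowerSeries σ ℂ} {R : ℝ}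
    (hS : S.AbsConverges R) {u : σ → A} (hu : ‖u‖ ≤ R) :
    HasSum (fun α : σ →₀ ℕ => coeff α S • ∏ j, u j ^ α j) (S.banachEval u) :=
  (hS.summable_norm hu).of_norm.hasSum

/-- The word listing the variables of a monomial with multiplicity. -/
noncomputable def monomialWord (α : σ →₀ ℕ) : Σ k : ℕ, Fin k → σ :=
  ⟨(Finsupp.toMultiset α).toList.length, (Finsupp.toMultiset α).toList.get⟩

-- A word determines its multiset of letters. Sums over multi-indices thus become sums over words,
-- which can be grouped by length.
omit [Fintype σ] in
theorem monomialWord_injective : Function.Injective (monomialWord (σ := σ)) := by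
  intro α β h
  have key : ∀ γ : σ →₀ ℕ,
      Multiset.ofList (List.ofFn (monomialWord γ).2) = Finsupp.toMultiset γ := fun γ => by
    simp [monomialWord]
  classical
  rw [← Finsupp.toMultiset_toFinsupp α, ← Finsupp.toMultiset_toFinsupp β, ← key α, ← key β, h]

omit [NormedAlgebra ℂ A] [NormOneClass A] in
theorem prod_monomialWord (α : σ →₀ ℕ) (u : σ → A) :
    ∏ i, u ((monomialWord α).2 i) = ∏ j, u j ^ α j := by
  have h1 : ∏ i, u ((monomialWord α).2 i) = ((Finsupp.toMultiset α).toList.map u).prod := by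
    rw [← List.prod_ofFn]
    congr 1
    change List.ofFn (u ∘ (Finsupp.toMultiset α).toList.get) = _
    rw [← List.map_ofFn, List.ofFn_get]
  rw [h1, ← Multiset.prod_coe, ← Multiset.map_coe, Multiset.coe_toList, Finsupp.toMultiset_map,
    Finsupp.prod_toMultiset, Finsupp.prod_mapDomain_index (by simp) (by simp [pow_add]),
    Finsupp.prod_fintype _ _ (by simp)]

/-- Coefficients of a power series, indexed by words. -/
noncomputable def wordCoeff (S : MvPowerSeries σ ℂ) : (Σ k : ℕ, Fin k → σ) → ℂ :=
  -- Only the chosen listing of each monomial carries its coefficient; every other word gets `0`, so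
  -- no symmetrization is needed.
  Function.extend monomialWord (fun α => coeff α S) 0

variable (A) in
/-- The multilinear map `(v₁, …, v_k) ↦ ∏ v_i (s i)` attached to a word `s`. -/
noncomputable def wordMultilinear {k : ℕ} (s : Fin k → σ) :
    ContinuousMultilinearMap ℂ (fun _ : Fin k => σ → A) A :=
  (ContinuousMultilinearMap.mkPiAlgebra ℂ (Fin k) A).compContinuousLinearMap
    fun i => ContinuousLinearMap.proj (s i)

theorem norm_wordMultilinear_le {k : ℕ} (s : Fin k → σ) : ‖wordMultilinear A s‖ ≤ 1 := by
  refine ContinuousMultilinearMap.opNorm_le_bound zero_le_one fun m => ?_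
  rw [one_mul]
  change ‖∏ i, m i (s i)‖ ≤ ∏ i, ‖m i‖
  exact (Finset.norm_prod_le _ _).trans
    (Finset.prod_le_prod (fun _ _ => norm_nonneg _) fun i _ => norm_le_pi_norm (m i) (s i))

variable (A) in
/-- The formal multilinear series underlying `banachEval`. -/
noncomputable def evalSeries (S : MvPowerSeries σ ℂ) : FormalMultilinearSeries ℂ (σ → A) A :=
  fun k => ∑ s : Fin k → σ, wordCoeff S ⟨k, s⟩ • wordMultilinear A s

/-- Grouping the absolutely summable series over words by length gives the homogeneous terms. Each
word contributes a multilinear map of norm at most `1`, which bounds the radius from below by `R`.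
-/
theorem AbsConverges.hasFPowerSeriesOnBall [CompleteSpace A] {S : MvPowerSeries σ ℂ} {R : NNReal}
    (hR : 0 < R) (hS : S.AbsConverges R) :
    HasFPowerSeriesOnBall (banachEval S : (σ → A) → A) (evalSeries A S) 0 R where
  r_le := by
    apply FormalMultilinearSeries.le_radius_of_summable
    have h : Summable fun w : Σ k : ℕ, Fin k → σ => ‖wordCoeff S w‖ * (R : ℝ) ^ w.1 := by
      rw [← monomialWord_injective.summable_iff]
      · refine hS.congr fun α => ?_
        simp only [Function.comp, wordCoeff, monomialWord_injective.extend_apply]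
        simp [monomialWord, Finsupp.card_toMultiset, Finsupp.degree_eq_sum, Finsupp.sum_fintype]
      · intro w hw
        simp [wordCoeff, Function.extend_apply' _ _ _ (by simpa using hw)]
    refine h.sigma.of_nonneg_of_le (fun _ => by positivity) fun k => ?_
    rw [tsum_fintype]
    change ‖evalSeries A S k‖ * (R : ℝ) ^ k ≤ ∑ s, ‖S.wordCoeff ⟨k, s⟩‖ * (R : ℝ) ^ k
    rw [← Finset.sum_mul]
    gcongr
    refine (norm_sum_le _ _).trans (Finset.sum_le_sum fun s _ => ?_)
    rw [norm_smul]
    exact mul_le_of_le_one_right (norm_nonneg _) (norm_wordMultilinear_le s)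
  r_pos := by simpa using hR
  hasSum := by
    intro y hy
    have hy' : ‖y‖ ≤ R := by
      have := hy
      simp only [Metric.mem_eball, edist_zero_right, ← ofReal_norm,
        ENNReal.ofReal_lt_coe_iff (norm_nonneg y)] at this
      exact this.le
    rw [zero_add]
    have h : HasSum (fun w : Σ k : ℕ, Fin k → σ => wordCoeff S w • ∏ i, y (w.2 i))
        (banachEval S y) := by
      rw [← monomialWord_injective.hasSum_iff]
      · refine (hS.hasSum hy').congr_fun ?_
        intro α
        simp only [Function.comp, wordCoeff, monomialWord_injective.extend_apply, prod_monomialWord]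
      · intro w hw
        simp [wordCoeff, Function.extend_apply' _ _ _ (by simpa using hw)]
    refine (h.sigma fun k => hasSum_fintype _).congr_fun fun k => ?_
    simp [evalSeries, wordMultilinear]

theorem AbsConverges.analyticOnNhd [CompleteSpace A] {S : MvPowerSeries σ ℂ} {R : ℝ}
    (hR : 0 < R) (hS : S.AbsConverges R) :
    AnalyticOnNhd ℂ (banachEval S : (σ → A) → A) (Metric.ball 0 R) := by
  lift R to NNReal using hR.le
  have h := (hS.hasFPowerSeriesOnBall (A := A) (by exact_mod_cast hR)).analyticOnNhd
  rwa [Metric.eball_coe] at h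

/-- With `χ` the evaluation of paths at a time `t`, this says that a series evaluated on paths acts
pointwise in time. -/
theorem AbsConverges.map_banachEval [CompleteSpace A] {B : Type*} [NormedCommRing B]
    [NormedAlgebra ℂ B] {S : MvPowerSeries σ ℂ} {R : ℝ} (hS : S.AbsConverges R)
    {u : σ → A} (hu : ‖u‖ ≤ R) (χ : A →A[ℂ] B) :
    χ (S.banachEval u) = S.banachEval fun j => χ (u j) := by
  rw [banachEval, banachEval, ((hS.hasSum hu).summable).map_tsum χ χ.continuous]
  simp

end BanachEval

/-! ### Differentiation and multiplication of convergent power series on `ℂⁿ`. -/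

section Complex

variable {σ : Type*} [Fintype σ]

theorem pow_add_mul_pow_mul_le {r d : ℝ} (hr : 0 ≤ r) (hd : 0 ≤ d) (k : ℕ) :
    r ^ (k + 1) + (k + 1) * r ^ k * d ≤ (r + d) ^ (k + 1) := by
  induction k with
  | zero => simp
  | succ k ih =>
    have h := mul_le_mul_of_nonneg_right ih (add_nonneg hr hd)
    have h2 : 0 ≤ ((k : ℝ) + 1) * r ^ k * d * d := by positivity
    rw [pow_succ (r + d)]
    push_cast
    refine le_trans ?_ h
    have h3 : (r ^ (k + 1) + ((k : ℝ) + 1) * r ^ k * d) * (r + d) =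
      r ^ (k + 1 + 1) + ((k : ℝ) + 1 + 1) * r ^ (k + 1) * d + ((k : ℝ) + 1) * r ^ k * d * d := by ring
    linarith

/-- The two leading binomial terms of `(r + (R - r)) ^ k`: the factor `k` produced by
differentiation is absorbed by passing to a smaller radius. -/
theorem natCast_mul_pow_le {r R : ℝ} (hr : 0 ≤ r) (hR : r < R) (k : ℕ) :
    k * r ^ (k - 1) ≤ R ^ k / (R - r) := by
  rw [le_div_iff₀ (sub_pos.2 hR)]
  cases k with
  | zero => simp
  | succ k =>
    have h := pow_add_mul_pow_mul_le hr (sub_nonneg.2 hR.le) k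
    have : 0 ≤ r ^ (k + 1) := by positivity
    simp only [add_sub_cancel, Nat.add_sub_cancel] at h ⊢
    push_cast
    linarith

theorem hasFDerivAt_monomial (α : σ →₀ ℕ) (u : σ → ℂ) :
    HasFDerivAt (fun u : σ → ℂ => ∏ j, u j ^ α j)
      (∑ j, ((α j : ℂ) * ∏ i, u i ^ (α - Finsupp.single j 1 : σ →₀ ℕ) i) •
        ContinuousLinearMap.proj (R := ℂ) (φ := fun _ : σ => ℂ) j) u := by
  classical
  have h := HasFDerivAt.finsetProd (u := Finset.univ) (x := u)
    (g := fun (j : σ) (u : σ → ℂ) => u j ^ α j) fun j _ =>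
    (ContinuousLinearMap.proj (R := ℂ) (φ := fun _ : σ => ℂ) j).hasFDerivAt.pow (α j)
  refine (h.congr_fderiv ?_).congr_of_eventuallyEq (.of_forall fun u => ?_)
  · refine Finset.sum_congr rfl fun j _ => ?_
    have : ∏ i, u i ^ (α - Finsupp.single j 1 : σ →₀ ℕ) i =
        (∏ i ∈ Finset.univ.erase j, u i ^ α i) * u j ^ (α j - 1) := by
      rw [← Finset.prod_erase_mul _ _ (Finset.mem_univ j)]
      congr 1
      · refine Finset.prod_congr rfl fun i hi => ?_
        rw [Finsupp.tsub_apply, Finsupp.single_eq_of_ne (Finset.ne_of_mem_erase hi), tsub_zero]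
      · simp
    rw [this]
    ext v
    simp
    ring
  · simp

omit [Fintype σ] in
theorem AbsConverges.pderiv {S : MvPowerSeries σ ℂ} {r R : ℝ} (hS : S.AbsConverges R)
    (hr : 0 ≤ r) (hR : r < R) (j : σ) : (MvPowerSeries.pderiv ℂ j S).AbsConverges r := by
  have h : Summable fun β : σ →₀ ℕ => ‖coeff (β + Finsupp.single j 1) S‖ *
      R ^ (β + Finsupp.single j 1).degree / (R - r) :=
    (hS.comp_injective (add_left_injective (Finsupp.single j 1))).div_const _
  refine h.of_nonneg_of_le (fun _ => by positivity) fun β => ?_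
  rw [coeff_pderiv, norm_mul, mul_assoc, mul_div_assoc]
  gcongr
  refine le_trans ?_ (natCast_mul_pow_le hr hR _)
  have h1 : (β + Finsupp.single j 1).degree = β.degree + 1 := by simp
  rw [h1, Nat.add_sub_cancel]
  gcongr
  have h2 : ‖(β j : ℂ) + 1‖ = ((β j + 1 : ℕ) : ℝ) := by
    rw [← Complex.norm_natCast]; push_cast; rfl
  rw [h2]
  have := Finsupp.le_degree j β
  exact_mod_cast Nat.succ_le_succ this

/-- Reindexing by `β ↦ β + eⱼ` misses only multi-indices with `αⱼ = 0`; their terms vanish, so the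
truncated subtraction is harmless. -/
theorem banachEval_pderiv (S : MvPowerSeries σ ℂ) (j : σ) (u : σ → ℂ) :
    (MvPowerSeries.pderiv ℂ j S).banachEval u =
      ∑' α : σ →₀ ℕ, coeff α S * (α j * ∏ i, u i ^ (α - Finsupp.single j 1 : σ →₀ ℕ) i) := by
  rw [← (add_left_injective (Finsupp.single j 1)).tsum_eq]
  · refine tsum_congr fun β => ?_
    rw [coeff_pderiv, add_tsub_cancel_right]
    simp
    ring
  · intro α hα
    have hj : α j ≠ 0 := by
      rintro h
      simp [h] at hα
    exact ⟨α - Finsupp.single j 1, tsub_add_cancel_of_le (by simpa [Nat.one_le_iff_ne_zero] using hj)⟩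

/-- Termwise differentiation on a ball of radius `r` with `‖u‖ < r < R`. Since the `αⱼ` add up to
the degree, `natCast_mul_pow_le` gives a summable majorant. -/
theorem AbsConverges.hasFDerivAt {S : MvPowerSeries σ ℂ} {R : ℝ} (hS : S.AbsConverges R)
    {u : σ → ℂ} (hu : ‖u‖ < R) :
    HasFDerivAt (banachEval S : (σ → ℂ) → ℂ)
      (∑ j, (MvPowerSeries.pderiv ℂ j S).banachEval u •
        ContinuousLinearMap.proj (R := ℂ) (φ := fun _ : σ => ℂ) j) u := by
  obtain ⟨r, hur, hrR⟩ := exists_between hu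
  have hr : 0 < r := (norm_nonneg u).trans_lt hur
  set f' : (σ →₀ ℕ) → (σ → ℂ) → (σ → ℂ) →L[ℂ] ℂ := fun α u =>
    ∑ j, (coeff α S * ((α j : ℂ) * ∏ i, u i ^ (α - Finsupp.single j 1 : σ →₀ ℕ) i)) •
        ContinuousLinearMap.proj (R := ℂ) (φ := fun _ : σ => ℂ) j with hf'
  have hterm : ∀ (α : σ →₀ ℕ) (u : σ → ℂ) (j : σ), ‖u‖ ≤ r →
      ‖coeff α S * ((α j : ℂ) * ∏ i, u i ^ (α - Finsupp.single j 1 : σ →₀ ℕ) i)‖ ≤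
        ‖coeff α S‖ * (α j * r ^ (α.degree - 1)) := by
    intro α u j hu
    rw [norm_mul, norm_mul, Complex.norm_natCast]
    by_cases hj : α j = 0
    · simp [hj]
    gcongr
    have : (α - Finsupp.single j 1).degree = α.degree - 1 := by
      have h1 : (α - Finsupp.single j 1) + Finsupp.single j 1 = α :=
        tsub_add_cancel_of_le (by simpa [Nat.one_le_iff_ne_zero] using hj)
      have h2 := congrArg Finsupp.degree h1
      simp at h2
      omega
    rw [← this]
    exact (norm_prod_pow_le u _).trans (pow_le_pow_left₀ (norm_nonneg _) hu _)
  have hbound : ∀ (α : σ →₀ ℕ) (u : σ → ℂ), ‖u‖ ≤ r →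
      ∑ j, ‖coeff α S * ((α j : ℂ) * ∏ i, u i ^ (α - Finsupp.single j 1 : σ →₀ ℕ) i)‖ ≤
        ‖coeff α S‖ * R ^ α.degree / (R - r) := by
    intro α u hu
    refine (Finset.sum_le_sum fun j _ => hterm α u j hu).trans ?_
    rw [← Finset.mul_sum, ← Finset.sum_mul, mul_div_assoc]
    gcongr
    refine le_trans (le_of_eq ?_) (natCast_mul_pow_le hr.le hrR _)
    rw [Finsupp.degree_eq_sum]
    push_cast
    rfl
  have hsum : Summable fun α : σ →₀ ℕ => ‖coeff α S‖ * R ^ α.degree / (R - r) := hS.div_const _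
  have hproj : ∀ j : σ, ‖ContinuousLinearMap.proj (R := ℂ) (φ := fun _ : σ => ℂ) j‖ ≤ 1 := fun j =>
    ContinuousLinearMap.opNorm_le_bound _ zero_le_one fun v => by
      simpa using norm_le_pi_norm v j
  have h := hasFDerivAt_tsum_of_isPreconnected (𝕜 := ℂ) hsum (Metric.isOpen_ball (x := 0) (ε := r))
    (convex_ball _ _).isPreconnected (x₀ := u) (x := u)
    (f := fun (α : σ →₀ ℕ) (u : σ → ℂ) => coeff α S • ∏ j, u j ^ α j) (f' := f')
    (fun α u _ => ((hasFDerivAt_monomial α u).const_smul (coeff α S)).congr_fderiv (by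
      simp [hf', Finset.smul_sum, smul_smul]))
    (fun α u hu => by
      refine le_trans ?_ (hbound α u (by simpa using (mem_ball_zero_iff.1 hu).le))
      refine (norm_sum_le _ _).trans (Finset.sum_le_sum fun j _ => ?_)
      rw [norm_smul]
      exact mul_le_of_le_one_right (norm_nonneg _) (hproj j))
    (by simpa using hur) (hS.hasSum hu.le).summable (by simpa using hur)
  refine h.congr_fderiv ?_
  simp only [hf', banachEval_pderiv]
  rw [Summable.tsum_finsetSum]
  · refine Finset.sum_congr rfl fun j _ => ?_
    rw [Summable.tsum_smul_const]
    exact hsum.of_norm_bounded fun α => (Finset.single_le_sum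
      (f := fun j => ‖coeff α S * ((α j : ℂ) * ∏ i, u i ^ (α - Finsupp.single j 1 : σ →₀ ℕ) i)‖)
      (fun i _ => norm_nonneg _) (Finset.mem_univ j)).trans (hbound α u hur.le)
  · intro j _
    refine Summable.smul_const ?_ _
    exact hsum.of_norm_bounded fun α => (Finset.single_le_sum
      (f := fun j => ‖coeff α S * ((α j : ℂ) * ∏ i, u i ^ (α - Finsupp.single j 1 : σ →₀ ℕ) i)‖)
      (fun i _ => norm_nonneg _) (Finset.mem_univ j)).trans (hbound α u hur.le)

theorem tsum_mul_tsum_eq_tsum_sum_antidiagonal_of_norm {M : Type*} [AddCommMonoid M]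
    [Finset.HasAntidiagonal M] {f g : M → ℂ} (hf : Summable fun x => ‖f x‖)
    (hg : Summable fun x => ‖g x‖) :
    (∑' α, f α) * ∑' α, g α = ∑' α, ∑ β ∈ Finset.HasAntidiagonal.antidiagonal α, f β.1 * g β.2 :=
  hf.of_norm.tsum_mul_tsum_eq_tsum_sum_antidiagonal hg.of_norm (summable_mul_of_summable_norm hf hg)

theorem AbsConverges.banachEval_mul {S T : MvPowerSeries σ ℂ} {R : ℝ} (hS : S.AbsConverges R)
    (hT : T.AbsConverges R) {u : σ → ℂ} (hu : ‖u‖ ≤ R) :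
    (S * T).banachEval u = S.banachEval u * T.banachEval u := by
  classical
  rw [banachEval, banachEval, banachEval,
    tsum_mul_tsum_eq_tsum_sum_antidiagonal_of_norm (hS.summable_norm hu) (hT.summable_norm hu)]
  refine tsum_congr fun α => ?_
  rw [coeff_mul, Finset.sum_smul]
  refine Finset.sum_congr rfl fun β hβ => ?_
  have h : α = β.1 + β.2 := (Finset.HasAntidiagonal.mem_antidiagonal.1 hβ).symm
  simp only [h, Finsupp.add_apply, pow_add, Finset.prod_mul_distrib, smul_eq_mul]
  ring

omit [Fintype σ] in
theorem AbsConverges.mul {S T : MvPowerSeries σ ℂ} {R : ℝ} (hR : 0 ≤ R) (hS : S.AbsConverges R)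
    (hT : T.AbsConverges R) : (S * T).AbsConverges R := by
  classical
  have h := summable_sum_mul_antidiagonal_of_summable_mul
    (Summable.mul_of_nonneg hS hT (fun _ => by positivity) fun _ => by positivity)
  refine h.of_nonneg_of_le (fun _ => by positivity) fun α => ?_
  rw [coeff_mul]
  refine (mul_le_mul_of_nonneg_right (norm_sum_le _ _) (by positivity)).trans (le_of_eq ?_)
  rw [Finset.sum_mul]
  refine Finset.sum_congr rfl fun β hβ => ?_
  rw [← Finset.HasAntidiagonal.mem_antidiagonal.1 hβ, norm_mul, map_add, pow_add]
  ring

theorem banachEval_sum {ι : Type*} (s : Finset ι) {S : ι → MvPowerSeries σ ℂ} {R : ℝ}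
    (hS : ∀ l, (S l).AbsConverges R) {u : σ → ℂ} (hu : ‖u‖ ≤ R) :
    (∑ l ∈ s, S l).banachEval u = ∑ l ∈ s, (S l).banachEval u := by
  rw [← (hasSum_sum fun l (_ : l ∈ s) => (hS l).hasSum hu).tsum_eq, banachEval]
  exact tsum_congr fun α => by rw [map_sum, Finset.sum_smul]

theorem banachEval_zero_right (S : MvPowerSeries σ ℂ) :
    S.banachEval (0 : σ → ℂ) = constantCoeff S := by
  rw [banachEval, tsum_eq_single 0]
  · simp
  · intro α hα
    obtain ⟨j, hj⟩ := DFunLike.ne_iff.1 hα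
    rw [Finset.prod_eq_zero (Finset.mem_univ j) (zero_pow hj), smul_zero]

end Complex

end MvPowerSeries

/-! ### Integration on the unit interval. -/

open Set unitInterval in
/-- Integration of continuous functions on the unit interval from `0` to `t`. -/
noncomputable def unitInterval.integralCLM : C(I, ℂ) →L[ℂ] C(I, ℂ) :=
  LinearMap.mkContinuous
    { toFun := fun f =>
        { toFun := fun t => ∫ s in (0 : ℝ)..t, f (projIcc 0 1 zero_le_one s)
          continuous_toFun :=
            (intervalIntegral.continuous_primitive (fun a b => Continuous.intervalIntegrable
              (f.continuous.comp continuous_projIcc) a b) 0).comp continuous_subtype_val }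
      map_add' := fun f g => by
        ext t
        exact intervalIntegral.integral_add
          ((f.continuous.comp continuous_projIcc).intervalIntegrable _ _)
          ((g.continuous.comp continuous_projIcc).intervalIntegrable _ _)
      map_smul' := fun c f => by
        ext t
        exact intervalIntegral.integral_smul c _ }
    1 fun f => by
      rw [one_mul, ContinuousMap.norm_le _ (norm_nonneg f)]
      intro t
      refine (intervalIntegral.norm_integral_le_of_norm_le_const
        (fun s _ => f.norm_coe_le_norm _)).trans ?_
      rw [sub_zero, abs_of_nonneg t.2.1]
      exact mul_le_of_le_one_right (norm_nonneg f) t.2.2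

namespace unitInterval

open Set

theorem integralCLM_apply (f : C(I, ℂ)) (t : I) :
    integralCLM f t = ∫ s in (0 : ℝ)..t, f (projIcc 0 1 zero_le_one s) :=
  rfl

theorem hasDerivAt_integralCLM (f : C(I, ℂ)) {s : ℝ} (hs : s ∈ Ioo (0 : ℝ) 1) :
    HasDerivAt (fun s => integralCLM f (projIcc 0 1 zero_le_one s))
      (f (projIcc 0 1 zero_le_one s)) s := by
  have h := (f.continuous.comp (continuous_projIcc (h := zero_le_one (α := ℝ)))).integral_hasStrictDerivAt 0 s
  refine h.hasDerivAt.congr_of_eventuallyEq ?_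
  filter_upwards [Ioo_mem_nhds hs.1 hs.2] with r hr
  rw [integralCLM_apply, projIcc_of_mem zero_le_one (Ioo_subset_Icc_self hr)]
  rfl

/-- The fundamental theorem of calculus; continuity up to the endpoints makes the derivative on the
open interval sufficient. -/
theorem eq_integralCLM_of_hasDerivAt {y f : C(I, ℂ)} (h0 : y 0 = 0)
    (h : ∀ s ∈ Ioo (0 : ℝ) 1, HasDerivAt (fun s => y (projIcc 0 1 zero_le_one s))
      (f (projIcc 0 1 zero_le_one s)) s) : y = integralCLM f := by
  ext t
  rw [integralCLM_apply, intervalIntegral.integral_eq_sub_of_hasDerivAt_of_le t.2.1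
    (y.continuous.comp continuous_projIcc).continuousOn
    (fun s hs => h s ⟨hs.1, hs.2.trans_le t.2.2⟩)
    ((f.continuous.comp continuous_projIcc).intervalIntegrable _ _)]
  simp [h0]

end unitInterval

/-! ### The flow as an integral equation on paths. -/

/-- Paths in `ℂⁿ` parametrized by the unit interval. -/
abbrev PathSpace (n : ℕ) : Type := Fin n → C(unitInterval, ℂ)

namespace PathSpace

open unitInterval

variable {n : ℕ}

/-- The position of a path at time `t`. -/
noncomputable def eval (t : I) : PathSpace n →L[ℂ] (Fin n → ℂ) :=
  ContinuousLinearMap.pi fun i => (ContinuousMap.evalCLM ℂ t).comp (ContinuousLinearMap.proj i)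

/-- Constant paths. -/
noncomputable def const : (Fin n → ℂ) →L[ℂ] PathSpace n :=
  ContinuousLinearMap.pi fun i =>
    (Algebra.linearMap ℂ C(I, ℂ)).toContinuousLinearMap.comp (ContinuousLinearMap.proj i)

/-- The path integral from time `0`, componentwise. -/
noncomputable def integral : PathSpace n →L[ℂ] PathSpace n :=
  ContinuousLinearMap.pi fun i => integralCLM.comp (ContinuousLinearMap.proj i)

@[simp] theorem eval_apply (t : I) (u : PathSpace n) (i : Fin n) : eval t u i = u i t := rfl

@[simp] theorem const_apply (z : Fin n → ℂ) (i : Fin n) (t : I) : const z i t = z i := by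
  simp [const]

@[simp] theorem integral_apply (u : PathSpace n) (i : Fin n) : integral u i = integralCLM (u i) :=
  rfl

theorem norm_eval_le (t : I) (u : PathSpace n) : ‖eval t u‖ ≤ ‖u‖ :=
  (pi_norm_le_iff_of_nonneg (norm_nonneg u)).2 fun i =>
    ((u i).norm_coe_le_norm t).trans (norm_le_pi_norm u i)

variable {p : ℕ}

/-- The parameter `xⱼ` as a linear form. -/
noncomputable def coordCLM (j : Fin p) : ((Fin p → ℂ) × (Fin n → ℂ)) × PathSpace n →L[ℂ] ℂ :=
  (ContinuousLinearMap.proj j).comp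
    ((ContinuousLinearMap.fst ℂ _ _).comp (ContinuousLinearMap.fst ℂ _ _))

@[simp] theorem coordCLM_apply (j : Fin p) (w : ((Fin p → ℂ) × (Fin n → ℂ)) × PathSpace n) :
    coordCLM j w = w.1.1 j := rfl

/-- The integral equation `u = z + ∫ ∑ⱼ xⱼ Fⱼ(u)` of the flow of `∑ⱼ xⱼ Fⱼ` started at `z`. -/
noncomputable def flowEquation (F : Fin p → PathSpace n → PathSpace n)
    (w : ((Fin p → ℂ) × (Fin n → ℂ)) × PathSpace n) : PathSpace n :=
  w.2 - const w.1.2 - integral (∑ j, w.1.1 j • F j w.2)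

variable {F : Fin p → PathSpace n → PathSpace n}

theorem analyticAt_flowEquation {w : ((Fin p → ℂ) × (Fin n → ℂ)) × PathSpace n}
    (h : ∀ j, AnalyticAt ℂ (F j) w.2) : AnalyticAt ℂ (flowEquation F) w := by
  unfold flowEquation
  refine (analyticAt_snd.sub ((const.analyticAt _).comp (analyticAt_snd.comp analyticAt_fst))).sub
    ((integral.analyticAt _).comp ?_)
  refine Finset.analyticAt_fun_sum _ fun j _ => ?_
  have hx : AnalyticAt ℂ (fun w : ((Fin p → ℂ) × (Fin n → ℂ)) × PathSpace n => w.1.1 j) w :=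
    (coordCLM j).analyticAt w
  exact hx.smul ((h j).comp analyticAt_snd)

theorem fderiv_flowEquation {w : ((Fin p → ℂ) × (Fin n → ℂ)) × PathSpace n}
    (h : ∀ j, DifferentiableAt ℂ (F j) w.2) (v : ((Fin p → ℂ) × (Fin n → ℂ)) × PathSpace n) :
    fderiv ℂ (flowEquation F) w v = v.2 - const v.1.2 -
      integral (∑ j, (w.1.1 j • fderiv ℂ (F j) w.2 v.2 + v.1.1 j • F j w.2)) := by
  have h1 : ∀ j, HasFDerivAt
      (fun w : ((Fin p → ℂ) × (Fin n → ℂ)) × PathSpace n => w.1.1 j • F j w.2) _ w := fun j =>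
    HasFDerivAt.smul (c := fun w : ((Fin p → ℂ) × (Fin n → ℂ)) × PathSpace n => w.1.1 j)
      (coordCLM j).hasFDerivAt
      ((h j).hasFDerivAt.comp w hasFDerivAt_snd)
  have h2 := (hasFDerivAt_snd.sub (const.hasFDerivAt.comp w
    (hasFDerivAt_snd.comp w hasFDerivAt_fst))).sub
      (integral.hasFDerivAt.comp w (HasFDerivAt.fun_sum fun j (_ : j ∈ Finset.univ) => h1 j))
  have h3 : HasFDerivAt (flowEquation F) _ w := h2
  rw [h3.fderiv]
  simp

/-- If `u` solves the flow equation of commuting fields, then `t ↦ t Fₖ(u(t))` solves the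
linearized equation describing the derivative of `u` with respect to the parameter `xₖ`. -/
theorem fderiv_flowEquation_of_commute {f : Fin p → (Fin n → ℂ) → (Fin n → ℂ)}
    {x : Fin p → ℂ} {z : Fin n → ℂ} {u : PathSpace n}
    (hF : ∀ j, DifferentiableAt ℂ (F j) u)
    (hf : ∀ j t, DifferentiableAt ℂ (f j) (eval t u))
    (hFf : ∀ j t, ∀ᶠ v in 𝓝 u, eval t (F j v) = f j (eval t v))
    (hcomm : ∀ j k t, fderiv ℂ (f j) (eval t u) (f k (eval t u)) =
      fderiv ℂ (f k) (eval t u) (f j (eval t u)))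
    (hu : flowEquation F ((x, z), u) = 0) (k : Fin p) :
    fderiv ℂ (flowEquation F) ((x, z), u)
      ((Pi.single k 1, 0), fun i => ⟨fun t : I => (t : ℂ) * F k u i t, by fun_prop⟩) = 0 := by
  set V : PathSpace n := fun i => ⟨fun t : I => (t : ℂ) * F k u i t, by fun_prop⟩ with hV
  have hVt : ∀ t, eval t V = (t : ℂ) • f k (eval t u) := fun t => by
    rw [← (hFf k t).self_of_nhds]
    rfl
  -- Differentiate the identity `eval t ∘ F j = f j ∘ eval t`, valid near `u`.
  have hlin : ∀ j t (v : PathSpace n), eval t (fderiv ℂ (F j) u v) =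
      fderiv ℂ (f j) (eval t u) (eval t v) := by
    intro j t v
    have h1 : HasFDerivAt (fun v => eval t (F j v)) ((eval t).comp (fderiv ℂ (F j) u)) u :=
      (eval t).hasFDerivAt.comp u (hF j).hasFDerivAt
    have h2 : HasFDerivAt (fun v => f j (eval t v))
        ((fderiv ℂ (f j) (eval t u)).comp (eval t)) u :=
      (hf j t).hasFDerivAt.comp u (eval t).hasFDerivAt
    exact DFunLike.congr_fun (h1.unique (h2.congr_of_eventuallyEq (hFf j t))) v
  have hu' : u = const z + integral (∑ j, x j • F j u) := by
    rw [flowEquation, sub_sub, sub_eq_zero] at hu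
    exact hu
  have hderiv : ∀ s ∈ Set.Ioo (0 : ℝ) 1,
      HasDerivAt (fun s => eval (Set.projIcc 0 1 zero_le_one s) u)
        (∑ j, x j • f j (eval (Set.projIcc 0 1 zero_le_one s) u)) s := by
    intro s hs
    rw [hasDerivAt_pi]
    intro i
    have h1 := (hasDerivAt_integralCLM (∑ j, x j • F j u i) hs).const_add (z i)
    have h2 : (∑ j, x j • F j u i) (Set.projIcc 0 1 zero_le_one s) =
        (∑ j, x j • f j (eval (Set.projIcc 0 1 zero_le_one s) u)) i := by
      simp [← (hFf _ _).self_of_nhds]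
    rw [← h2]
    refine h1.congr_of_eventuallyEq (.of_forall fun r => ?_)
    have h3 := congrArg (fun v : PathSpace n => v i (Set.projIcc 0 1 zero_le_one r)) hu'
    simpa using h3
  rw [fderiv_flowEquation hF]
  simp only [map_zero, sub_zero]
  rw [sub_eq_zero]
  funext i
  refine eq_integralCLM_of_hasDerivAt (by simp [hV]) fun s hs => ?_
  set τ := Set.projIcc (0 : ℝ) 1 zero_le_one s with hτ
  have hτs : (τ : ℝ) = s := by
    rw [hτ, Set.projIcc_of_mem zero_le_one (Set.Ioo_subset_Icc_self hs)]
  have h0 : HasDerivAt (fun s : ℝ => f k (eval (Set.projIcc 0 1 zero_le_one s) u))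
      (fderiv ℂ (f k) (eval τ u) (∑ j, x j • f j (eval τ u))) s := by
    have hk : HasFDerivAt (f k) ((fderiv ℂ (f k) (eval τ u)).restrictScalars ℝ) (eval τ u) :=
      (hf k τ).hasFDerivAt.restrictScalars ℝ
    exact hk.comp_hasDerivAt s (hderiv s hs)
  have h1 : HasDerivAt (fun s : ℝ => (s : ℂ) • f k (eval (Set.projIcc 0 1 zero_le_one s) u))
      ((s : ℂ) • fderiv ℂ (f k) (eval τ u) (∑ j, x j • f j (eval τ u)) +
        (1 : ℂ) • f k (eval τ u)) s :=
    (Complex.ofRealCLM.hasDerivAt (x := s)).smul h0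
  have h2 := (hasDerivAt_pi.1 h1) i
  -- Commutation enters here: it turns `Dfⱼ(fₖ)`, from the linearized equation at `V`, into
  -- `Dfₖ(fⱼ)`, from differentiating `s fₖ(u(s))` along the flow.
  have h3 : eval τ (∑ j, (x j • fderiv ℂ (F j) u V + (Pi.single k 1 : Fin p → ℂ) j • F j u)) =
      (s : ℂ) • fderiv ℂ (f k) (eval τ u) (∑ j, x j • f j (eval τ u)) +
        (1 : ℂ) • f k (eval τ u) := by
    simp only [map_sum, map_add, map_smul, hlin, hVt, (hFf _ _).self_of_nhds,
      Finset.sum_add_distrib, hcomm _ k, hτs, Finset.smul_sum, smul_comm (s : ℂ)]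
    simp [Pi.single_apply]
  refine HasDerivAt.congr_deriv (HasDerivAt.congr_of_eventuallyEq h2 ?_) (congrFun h3 i).symm
  filter_upwards [Ioo_mem_nhds hs.1 hs.2] with r hr
  have h4 := congrFun (hVt (Set.projIcc 0 1 zero_le_one r)) i
  rw [eval_apply] at h4
  rw [h4, Set.projIcc_of_mem zero_le_one (Set.Ioo_subset_Icc_self hr)]

end PathSpace

/-! ### Solving the flow equation. -/

/-- Analytic implicit function theorem, with a characterization of the derivatives of the implicit
function near the base point. -/
theorem AnalyticAt.exists_implicitFunction {P B : Type*} [NormedAddCommGroup P] [NormedSpace ℂ P]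
    [CompleteSpace P] [NormedAddCommGroup B] [NormedSpace ℂ B] [CompleteSpace B]
    {G : P × B → B} (hG : AnalyticAt ℂ G 0) (hG0 : G 0 = 0)
    (hinr : ∀ V, fderiv ℂ G 0 (0, V) = V) :
    ∃ U : P → B, AnalyticAt ℂ U 0 ∧ U 0 = 0 ∧ ∀ᶠ w in 𝓝 0, G (w, U w) = 0 ∧
      DifferentiableAt ℂ U w ∧
      ∀ v V, fderiv ℂ G (w, U w) (v, V) = 0 → fderiv ℂ U w v = V := by
  have hinr' : fderiv ℂ G 0 ∘L .inr ℂ P B = .id ℂ _ := by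
    ext1 v
    exact hinr v
  have hinv : (fderiv ℂ G 0 ∘L .inr ℂ P B).IsInvertible := by
    rw [hinr']
    exact ⟨.refl ℂ _, rfl⟩
  have hGc : ContDiffAt ℂ ⊤ G 0 := hG.contDiffAt
  set U := hGc.implicitFunction (by simp) hinv with hU
  have hUan : AnalyticAt ℂ U 0 :=
    (hGc.contDiffAt_implicitFunction (by simp) hinv).analyticAt
  have hU0 : U 0 = 0 := hGc.implicitFunction_apply_self (by simp) hinv
  have hUG : ∀ᶠ w in 𝓝 (0 : P), G (w, U w) = 0 := by
    have := hGc.eventually_apply_implicitFunction (by simp) hinv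
    rwa [hG0] at this
  have hpair : AnalyticAt ℂ (fun w => (w, U w)) 0 := AnalyticAt.prod analyticAt_id hUan
  have h2 : ((0 : P), U 0) = 0 := by rw [hU0]; rfl
  have hG1 : AnalyticAt ℂ G ((0 : P), U 0) := h2 ▸ hG
  -- Within distance `1` of the identity the partial derivative is injective: a nonzero `Z` in its
  -- kernel would satisfy `‖Z‖ < ‖Z‖`.
  have hnear : ∀ᶠ w in 𝓝 (0 : P), ‖fderiv ℂ G (w, U w) ∘L .inr ℂ P B - .id ℂ _‖ < 1 := by
    have hc : ContinuousAt (fun w => ‖fderiv ℂ G (w, U w) ∘L .inr ℂ P B - .id ℂ _‖) 0 := by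
      have h1 : ContinuousAt (fun w => fderiv ℂ G (w, U w)) 0 :=
        ContinuousAt.comp (f := fun w => (w, U w)) hG1.fderiv.continuousAt hpair.continuousAt
      exact ((h1.clm_comp continuousAt_const).sub continuousAt_const).norm
    refine hc.eventually_lt continuousAt_const ?_
    rw [h2, hinr']
    simp
  refine ⟨U, hUan, hU0, ?_⟩
  filter_upwards [hnear, hUG.eventually_nhds, hUan.eventually_analyticAt,
      hpair.continuousAt.eventually hG1.eventually_analyticAt] with w hw1 hw2 hw3 hw4
  refine ⟨hw2.self_of_nhds, hw3.differentiableAt, fun v V hV => ?_⟩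
  have hchain : fderiv ℂ G (w, U w) (v, fderiv ℂ U w v) = 0 := by
    have h4 := hw4.differentiableAt.hasFDerivAt.comp w
      ((hasFDerivAt_id w).prodMk hw3.differentiableAt.hasFDerivAt)
    have h5 := h4.unique ((hasFDerivAt_const (0 : B) w).congr_of_eventuallyEq hw2)
    exact DFunLike.congr_fun h5 v
  by_contra hne
  rw [← sub_eq_zero] at hne
  set Z := fderiv ℂ U w v - V with hZ
  have h4 : fderiv ℂ G (w, U w) (0, Z) = 0 := by
    have h5 : ((0 : P), Z) = (v, fderiv ℂ U w v) - (v, V) := by simp [hZ]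
    rw [h5, map_sub, hchain, hV, sub_zero]
  have h6 := (fderiv ℂ G (w, U w) ∘L .inr ℂ P B - .id ℂ _).le_opNorm Z
  have h7 := mul_lt_mul_of_pos_right hw1 (norm_pos_iff.2 hne)
  simp [h4] at h6 h7
  linarith

namespace PathSpace

open unitInterval

variable {n p : ℕ}

/-- Commuting analytic vector fields `fⱼ` near `0 ∈ ℂⁿ` admit a joint analytic flow. The maps `Fⱼ`
are the corresponding superposition operators on paths. -/
theorem exists_analytic_flow {F : Fin p → PathSpace n → PathSpace n}
    {f : Fin p → (Fin n → ℂ) → (Fin n → ℂ)} {R : ℝ} (hR : 0 < R)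
    (hF : ∀ j, AnalyticOnNhd ℂ (F j) (Metric.ball 0 R))
    (hf : ∀ j, AnalyticOnNhd ℂ (f j) (Metric.ball 0 R))
    (hFf : ∀ j t, ∀ u ∈ Metric.ball (0 : PathSpace n) R, eval t (F j u) = f j (eval t u))
    (hcomm : ∀ j k, ∀ v ∈ Metric.ball (0 : Fin n → ℂ) R,
      fderiv ℂ (f j) v (f k v) = fderiv ℂ (f k) v (f j v)) :
    ∃ Φ : (Fin p → ℂ) × (Fin n → ℂ) → (Fin n → ℂ), AnalyticAt ℂ Φ 0 ∧ Φ 0 = 0 ∧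
      (∀ z, fderiv ℂ Φ 0 (0, z) = z) ∧
      ∀ᶠ w in 𝓝 0, ∀ k, fderiv ℂ Φ w (Pi.single k 1, 0) = f k (Φ w) := by
  have h0 : (0 : PathSpace n) ∈ Metric.ball (0 : PathSpace n) R := Metric.mem_ball_self hR
  have hG : AnalyticAt ℂ (flowEquation F) 0 := analyticAt_flowEquation fun j => hF j _ h0
  have hz : ∀ (c : ℂ) (u : PathSpace n), c = 0 → c • u = 0 := fun c u hc => by
    rw [hc]
    exact funext fun i => zero_smul ℂ (u i)
  have hG0 : flowEquation F 0 = 0 := by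
    unfold flowEquation
    rw [Finset.sum_eq_zero, map_zero]
    · simp
    · exact fun j _ => hz _ _ rfl
  have hG' : ∀ z V, fderiv ℂ (flowEquation F) 0 ((0, z), V) = V - const z := fun z V => by
    rw [fderiv_flowEquation fun j => (hF j _ h0).differentiableAt, Finset.sum_eq_zero, map_zero,
      sub_zero]
    intro j _
    exact (congrArg₂ (· + ·) (hz _ _ rfl) (hz _ _ rfl)).trans (add_zero _)
  obtain ⟨U, hUan, hU0, hU⟩ := hG.exists_implicitFunction hG0 fun V => by
    have := hG' 0 V
    rwa [map_zero, sub_zero] at this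
  refine ⟨fun w => eval 1 (U w), ((eval 1).analyticAt _).comp hUan, by simp [hU0], fun z => ?_, ?_⟩
  · obtain ⟨-, hd, h1⟩ := hU.self_of_nhds
    have h3 : HasFDerivAt (fun w => eval 1 (U w)) ((eval 1).comp (fderiv ℂ U 0)) 0 :=
      (eval 1).hasFDerivAt.comp 0 hd.hasFDerivAt
    rw [h3.fderiv, ContinuousLinearMap.comp_apply, h1 (0, z) (const z)]
    · ext i
      simp
    · rw [hU0]
      exact (hG' z (const z)).trans (sub_self _)
  · filter_upwards [hU, hUan.continuousAt.eventually
      (by rw [hU0]; exact Metric.ball_mem_nhds 0 hR)] with w ⟨hw1, hw2, hw3⟩ hw5 k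
    have hball : ∀ t, eval t (U w) ∈ Metric.ball (0 : Fin n → ℂ) R := fun t =>
      mem_ball_zero_iff.2 ((norm_eval_le t _).trans_lt (mem_ball_zero_iff.1 hw5))
    have h2 := fderiv_flowEquation_of_commute (x := w.1) (z := w.2)
      (fun j => (hF j _ hw5).differentiableAt)
      (fun j t => (hf j _ (hball t)).differentiableAt)
      (fun j t => Filter.mem_of_superset (Metric.isOpen_ball.mem_nhds hw5) fun v hv => hFf j t v hv)
      (fun j l t => hcomm j l _ (hball t)) hw1 k
    have h3' : HasFDerivAt (fun w => eval 1 (U w)) ((eval 1).comp (fderiv ℂ U w)) w :=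
      (eval 1).hasFDerivAt.comp w hw2.hasFDerivAt
    -- At time `1` the factor `t` in the linearized solution equals `1`.
    rw [h3'.fderiv, ContinuousLinearMap.comp_apply, hw3 _ _ h2, ← hFf k 1 _ hw5]
    ext i
    simp

end PathSpace

/-! ### Straightening by the inverse function theorem. -/

/-- Linearly independent vectors in `ℂⁿ` can be completed to a basis: the map
`(x, y) ↦ ∑ⱼ xⱼ bⱼ + ι y` is an isomorphism for a suitable `ι`. -/
theorem LinearIndependent.exists_complement {n p q : ℕ} {b : Fin p → (Fin n → ℂ)}
    (hb : LinearIndependent ℂ b) (hpq : p + q = n) :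
    ∃ ι : (Fin q → ℂ) →L[ℂ] (Fin n → ℂ), ∃ e : ((Fin p → ℂ) × (Fin q → ℂ)) ≃L[ℂ] (Fin n → ℂ),
      ∀ x y, e (x, y) = ∑ j, x j • b j + ι y := by
  obtain ⟨C, hC⟩ := (Submodule.span ℂ (Set.range b)).exists_isCompl
  have h1 : Module.finrank ℂ (Submodule.span ℂ (Set.range b)) = p := by
    simpa using finrank_span_eq_card hb
  have h2 : Module.finrank ℂ C = q := by
    have := Submodule.finrank_add_eq_of_isCompl hC
    rw [h1, Module.finrank_fin_fun] at this
    omega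
  let ε : (Fin q → ℂ) ≃ₗ[ℂ] C := LinearEquiv.ofFinrankEq _ _ (by simp [h2])
  let β : (Fin p → ℂ) ≃ₗ[ℂ] Submodule.span ℂ (Set.range b) := (Module.Basis.span hb).equivFun.symm
  let e := (β.prodCongr ε).trans (Submodule.prodEquivOfIsCompl _ C hC)
  refine ⟨(C.subtype.comp ε.toLinearMap).toContinuousLinearMap, e.toContinuousLinearEquiv,
    fun x y => ?_⟩
  simp [e, β, Module.Basis.equivFun_symm_apply, Module.Basis.span_apply]

/-- Flowing out of the transversal slice `ι(ℂ^q)`, the map `ψ(x, y) = Φ(x, ι y)` carries `∂/∂xₖ` to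
`fₖ`. Its derivative at `0` is the isomorphism `e`, so a local inverse of `ψ` is the chart. -/
theorem AnalyticAt.exists_straightening {n p q : ℕ} {R : ℝ} (hR : 0 < R)
    {f : Fin p → (Fin n → ℂ) → (Fin n → ℂ)} {Φ : (Fin p → ℂ) × (Fin n → ℂ) → (Fin n → ℂ)}
    (hΦ : AnalyticAt ℂ Φ 0) (hΦ0 : Φ 0 = 0) (hΦz : ∀ z, fderiv ℂ Φ 0 (0, z) = z)
    (hΦf : ∀ᶠ w in 𝓝 0, ∀ k, fderiv ℂ Φ w (Pi.single k 1, 0) = f k (Φ w))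
    (hli : LinearIndependent ℂ fun j => f j 0) (hpq : p + q = n) :
    ∃ φ : OpenPartialHomeomorph (Fin n → ℂ) ((Fin p → ℂ) × (Fin q → ℂ)),
      IsAnalyticCoordinateSystem φ ∧ φ.source ⊆ Metric.ball 0 R ∧
      ∀ v ∈ φ.source, ∀ k, fderiv ℂ φ v (f k v) = (Pi.single k 1, 0) := by
  obtain ⟨ι, e, he⟩ := hli.exists_complement hpq
  set L : (Fin p → ℂ) × (Fin q → ℂ) →L[ℂ] (Fin p → ℂ) × (Fin n → ℂ) :=
    (ContinuousLinearMap.id ℂ _).prodMap ι with hL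
  set ψ : (Fin p → ℂ) × (Fin q → ℂ) → (Fin n → ℂ) := fun w => Φ (L w) with hψ
  have hL0 : L 0 = 0 := map_zero L
  have hψan : AnalyticAt ℂ ψ 0 :=
    AnalyticAt.comp (g := Φ) (f := L) (by rwa [hL0]) (L.analyticAt 0)
  have hψ0 : ψ 0 = 0 := by simp only [hψ, hL0, hΦ0]
  have hψ' : HasFDerivAt ψ (e : (Fin p → ℂ) × (Fin q → ℂ) →L[ℂ] (Fin n → ℂ)) 0 := by
    have h1 : HasFDerivAt ψ ((fderiv ℂ Φ 0).comp L) 0 := by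
      have := hΦ.differentiableAt.hasFDerivAt
      rw [← hL0] at this
      have h := this.comp 0 L.hasFDerivAt
      rwa [hL0] at h
    refine h1.congr_fderiv ?_
    refine ContinuousLinearMap.ext fun ⟨x, y⟩ => ?_
    have h2 : L (x, y) = ∑ j, x j • ((Pi.single j 1 : Fin p → ℂ), (0 : Fin n → ℂ)) + (0, ι y) := by
      ext i <;> simp [hL, Prod.fst_sum, Prod.snd_sum, Pi.single_apply]
    have h3 := hΦf.self_of_nhds
    rw [hΦ0] at h3
    rw [ContinuousLinearMap.comp_apply, h2, map_add, map_sum, hΦz]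
    simp only [map_smul, h3]
    exact (he x y).symm
  have hψc : ContDiffAt ℂ ⊤ ψ 0 := hψan.contDiffAt
  set H := hψc.toOpenPartialHomeomorph ψ hψ' (by simp) with hH
  have hH0 : (0 : (Fin p → ℂ) × (Fin q → ℂ)) ∈ H.source :=
    hψc.mem_toOpenPartialHomeomorph_source hψ' (by simp)
  have hev : ∀ᶠ w in 𝓝 (0 : (Fin p → ℂ) × (Fin q → ℂ)), AnalyticAt ℂ ψ w ∧
      (∃ e' : ((Fin p → ℂ) × (Fin q → ℂ)) ≃L[ℂ] (Fin n → ℂ),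
        (e' : (Fin p → ℂ) × (Fin q → ℂ) →L[ℂ] (Fin n → ℂ)) = fderiv ℂ ψ w) ∧
      (∀ k, fderiv ℂ ψ w (Pi.single k 1, 0) = f k (ψ w)) ∧ ψ w ∈ Metric.ball 0 R := by
    have hLc : Tendsto L (𝓝 0) (𝓝 0) := by
      simpa [hL0] using L.continuous.tendsto 0
    filter_upwards [hψan.eventually_analyticAt, hLc.eventually hΦf,
      hLc.eventually hΦ.eventually_analyticAt,
      hψan.continuousAt.eventually (by rw [hψ0]; exact Metric.ball_mem_nhds 0 hR),
      hψan.fderiv.continuousAt.eventually (by rw [hψ'.fderiv]; exact e.nhds)]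
      with w h1 h2 h3 h4 h5
    refine ⟨h1, h5, fun k => ?_, h4⟩
    have h6 : HasFDerivAt ψ ((fderiv ℂ Φ (L w)).comp L) w :=
      h3.differentiableAt.hasFDerivAt.comp w L.hasFDerivAt
    rw [h6.fderiv, ContinuousLinearMap.comp_apply, ← h2 k]
    congr 1
    simp [hL]
  obtain ⟨N, hN, hNo, hN0⟩ := eventually_nhds_iff.1 hev
  -- The local inverse is shrunk so that analyticity, invertibility of `Dψ` and the flow identity
  -- hold on the whole chart domain.
  set K := H.restrOpen N hNo with hK
  have hKs : K.source = H.source ∩ N := rfl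
  have hK0 : (0 : (Fin p → ℂ) × (Fin q → ℂ)) ∈ K.source := ⟨hH0, hN0⟩
  have hKψ : (K : (Fin p → ℂ) × (Fin q → ℂ) → (Fin n → ℂ)) = ψ := rfl
  have hmem : ∀ v ∈ K.target, K.symm v ∈ N := fun v hv => (K.map_target hv).2
  have hval : ∀ v ∈ K.target, ψ (K.symm v) = v := fun v hv => K.right_inv hv
  refine ⟨K.symm, ⟨?_, ?_, fun v hv => ?_, fun w hw => (hN w hw.2).1⟩, fun v hv => ?_,
    fun v hv k => ?_⟩
  · have := K.map_source hK0
    rwa [hKψ, hψ0] at this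
  · have := K.left_inv hK0
    rwa [hKψ, hψ0] at this
  · obtain ⟨h1, ⟨e', he'⟩, -⟩ := hN _ (hmem v hv)
    exact K.analyticAt_symm hv h1 he'.symm
  · have := (hN _ (hmem v hv)).2.2.2
    rwa [hval v hv] at this
  · obtain ⟨h1, ⟨e', he'⟩, h3, -⟩ := hN _ (hmem v hv)
    have h4 : HasFDerivAt K.symm (e'.symm : (Fin n → ℂ) →L[ℂ] (Fin p → ℂ) × (Fin q → ℂ)) v :=
      K.hasFDerivAt_symm hv (by rw [he']; exact h1.differentiableAt.hasFDerivAt)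
    rw [h4.fderiv]
    have h5 := h3 k
    rw [hval v hv, ← he'] at h5
    rw [← h5]
    exact e'.symm_apply_apply _

/-! ### Convergent formal vector fields and their brackets. -/

namespace FormalVectorField

variable {n : ℕ}

/-- Summability in `ℂ` is absolute, so convergence at the diagonal point `(R, …, R)` already bounds
the whole polydisc. -/
theorem IsAnalytic.eventually_absConverges {S : FormalVectorField n} (hS : S.IsAnalytic) :
    ∀ᶠ R : ℝ in 𝓝[>] 0, ∀ i, (S i).AbsConverges R := by
  have h1 : Tendsto (fun R : ℝ => fun _ : Fin n => (R : ℂ)) (𝓝 0) (𝓝 0) :=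
    Continuous.tendsto' (by fun_prop) 0 0 (by ext; simp)
  filter_upwards [(h1.eventually hS).filter_mono nhdsWithin_le_nhds, self_mem_nhdsWithin]
    with R ⟨w, hw⟩ hR i
  refine (hw i).summable.norm.congr fun α => ?_
  rw [norm_mul, Finset.prod_pow_eq_pow_sum, norm_pow, Complex.norm_real, Real.norm_eq_abs,
    abs_of_pos hR, Finsupp.degree_eq_sum]

/-- The value of a formal vector field at a point where it converges. -/
noncomputable def value (S : FormalVectorField n) (v : Fin n → ℂ) : Fin n → ℂ :=
  fun i => (S i).banachEval v

theorem hasValueAt_value {S : FormalVectorField n} {R : ℝ} (hS : ∀ i, (S i).AbsConverges R)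
    {v : Fin n → ℂ} (hv : ‖v‖ ≤ R) : S.HasValueAt v (S.value v) :=
  fun i => (hS i).hasSum hv

theorem value_zero_right (S : FormalVectorField n) : S.value 0 = S.constantPart :=
  funext fun i => (S i).banachEval_zero_right

theorem HasValueAt.sum_smul {ι : Type*} (s : Finset ι) (c : ι → ℂ) {S : ι → FormalVectorField n}
    {v : Fin n → ℂ} {w : ι → Fin n → ℂ} (h : ∀ j, (S j).HasValueAt v (w j)) :
    (∑ j ∈ s, c j • S j).HasValueAt v (∑ j ∈ s, c j • w j) := by
  intro i
  have h1 := hasSum_sum fun j (_ : j ∈ s) => (h j i).mul_left (c j)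
  simp only [Finset.sum_apply, Pi.smul_apply, map_sum, map_smul, smul_eq_mul, Finset.sum_mul]
  simpa only [mul_assoc] using h1

theorem fderiv_value {S : FormalVectorField n} {R : ℝ} (hS : ∀ i, (S i).AbsConverges R)
    {v : Fin n → ℂ} (hv : ‖v‖ < R) (w : Fin n → ℂ) (i : Fin n) :
    fderiv ℂ S.value v w i = ∑ l, (MvPowerSeries.pderiv ℂ l (S i)).banachEval v * w l := by
  have h : HasFDerivAt S.value _ v := hasFDerivAt_pi.2 fun i => (hS i).hasFDerivAt hv
  rw [h.fderiv]
  simp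

/-- Evaluation is multiplicative and commutes with differentiation, so the formal bracket identity
passes to values. The intermediate radius `r` leaves room for convergence of the derivatives. -/
theorem fderiv_value_comm_of_lieBracket_eq_zero {S T : FormalVectorField n} {R : ℝ}
    (hS : ∀ i, (S i).AbsConverges R) (hT : ∀ i, (T i).AbsConverges R) (h : lieBracket S T = 0)
    {v : Fin n → ℂ} (hv : ‖v‖ < R) :
    fderiv ℂ S.value v (T.value v) = fderiv ℂ T.value v (S.value v) := by
  obtain ⟨r, hvr, hrR⟩ := exists_between hv
  have hr : 0 ≤ r := (norm_nonneg v).trans hvr.le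
  have key : ∀ {S T : FormalVectorField n}, (∀ i, (S i).AbsConverges R) →
      (∀ i, (T i).AbsConverges R) → ∀ i, fderiv ℂ S.value v (T.value v) i =
        (∑ l, T l * MvPowerSeries.pderiv ℂ l (S i)).banachEval v := by
    intro S T hS hT i
    have h1 : ∀ l, (T l).AbsConverges r := fun l => (hT l).mono hr hrR.le
    have h2 : ∀ l, (MvPowerSeries.pderiv ℂ l (S i)).AbsConverges r := fun l =>
      (hS i).pderiv hr hrR l
    rw [fderiv_value hS hv, MvPowerSeries.banachEval_sum _ (fun l => (h1 l).mul hr (h2 l)) hvr.le]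
    refine Finset.sum_congr rfl fun l _ => ?_
    rw [(h1 l).banachEval_mul (h2 l) hvr.le, mul_comm]
    rfl
  funext i
  rw [key hS hT, key hT hS]
  have h3 := congrFun h i
  rw [lieBracket, Finset.sum_sub_distrib] at h3
  rw [sub_eq_zero.1 h3]

/-- Simultaneous straightening of commuting analytic vector fields that are linearly independent at
the origin. -/
theorem exists_straightening {p q : ℕ} {S : Fin p → FormalVectorField n}
    (hS : ∀ j, (S j).IsAnalytic) (hcomm : ∀ j k, lieBracket (S j) (S k) = 0)
    (hli : LinearIndependent ℂ fun j => (S j).constantPart) (hpq : p + q = n) :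
    ∃ φ : OpenPartialHomeomorph (Fin n → ℂ) ((Fin p → ℂ) × (Fin q → ℂ)),
      IsAnalyticCoordinateSystem φ ∧ ∀ v ∈ φ.source, ∀ k,
        (S k).HasValueAt v ((S k).value v) ∧ fderiv ℂ φ v ((S k).value v) = (Pi.single k 1, 0) := by
  obtain ⟨R, hconv, hR⟩ := ((eventually_all.2 fun j => (hS j).eventually_absConverges).and
    self_mem_nhdsWithin).exists
  have hR : 0 < R := hR
  obtain ⟨Φ, hΦ, hΦ0, hΦz, hΦf⟩ := PathSpace.exists_analytic_flow hR
    (F := fun j u i => (S j i).banachEval u) (f := fun j => (S j).value)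
    (fun j => AnalyticOnNhd.pi fun i => (hconv j i).analyticOnNhd hR)
    (fun j => AnalyticOnNhd.pi fun i => (hconv j i).analyticOnNhd hR)
    (fun j t u hu => funext fun i => (hconv j i).map_banachEval (mem_ball_zero_iff.1 hu).le
      { ContinuousMap.evalAlgHom ℂ ℂ t with cont := continuous_eval_const t })
    (fun j k v hv => fderiv_value_comm_of_lieBracket_eq_zero (hconv j) (hconv k) (hcomm j k)
      (mem_ball_zero_iff.1 hv))
  obtain ⟨φ, hφ, hsub, hφS⟩ := hΦ.exists_straightening hR hΦ0 hΦz hΦf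
    (by simpa only [value_zero_right] using hli) hpq
  exact ⟨φ, hφ, fun v hv k =>
    ⟨hasValueAt_value (hconv k) (mem_ball_zero_iff.1 (hsub hv)).le, hφS v hv k⟩⟩

end FormalVectorField

/-! ### Application to the abelian ideal. -/

theorem proposition3p1 {𝔤 : Type*} [LieRing 𝔤] [LieAlgebra ℂ 𝔤] [FiniteDimensional ℂ 𝔤]
    (𝔤₀ : LieSubalgebra ℂ 𝔤) (𝔪 : LieIdeal ℂ 𝔤) (h𝔪 : IsLieAbelian 𝔪)
    (hsum : 𝔤₀.toSubmodule ⊔ 𝔪.toSubmodule = ⊤)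
    {n : ℕ} (T : 𝔤 →ₗ[ℂ] FormalVectorField n)
    (hT : IsNonlinearRepresentation T)
    (hTan : ∀ X : 𝔤, (T X).IsAnalytic)
    (hT₀ : ∀ X ∈ 𝔤₀, (T X).constantPart = 0)
    (hT𝔪 : ∀ X ∈ 𝔪, X ≠ 0 → (T X).constantPart ≠ 0) :
    ∃ p q : ℕ, p = Module.finrank ℂ 𝔪 ∧ p + q = n ∧
      ∃ φ : OpenPartialHomeomorph (Fin n → ℂ) ((Fin p → ℂ) × (Fin q → ℂ)),
        IsAnalyticCoordinateSystem φ ∧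
        ∃ a : Fin p → Module.Dual ℂ 𝔪,
          ∀ X : 𝔪, (T X).IsConstantIn φ (fun i => a i X) := by
  let b := Module.finBasis ℂ 𝔪
  let C : 𝔪 →ₗ[ℂ] (Fin n → ℂ) :=
    { toFun := fun X => (T X).constantPart
      map_add' := fun X Y => by
        ext i
        simp [FormalVectorField.constantPart]
      map_smul' := fun c X => by
        ext i
        simp [FormalVectorField.constantPart] }
  have hC : LinearMap.ker C = ⊥ := by
    refine LinearMap.ker_eq_bot'.2 fun X hX => ?_
    by_contra hne
    exact hT𝔪 X X.2 (fun h => hne (Subtype.ext h)) hX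
  have hli : LinearIndependent ℂ fun j => (T (b j)).constantPart :=
    b.linearIndependent.map' C hC
  have hle : Module.finrank ℂ 𝔪 ≤ n := by
    simpa using hli.fintype_card_le_finrank
  have hcomm : ∀ X Y : 𝔪, FormalVectorField.lieBracket (T X) (T Y) = 0 := by
    intro X Y
    have h : ⁅(X : 𝔤), (Y : 𝔤)⁆ = 0 := by
      have := congrArg (Subtype.val : 𝔪 → 𝔤) (trivial_lie_zero 𝔪 𝔪 X Y)
      simpa using this
    rw [← hT, h, map_zero]
  have hpq := Nat.add_sub_cancel' hle
  obtain ⟨φ, hφ, hφT⟩ := FormalVectorField.exists_straightening (S := fun j => T (b j))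
    (fun j => hTan (b j)) (fun j k => hcomm (b j) (b k)) hli hpq
  -- The chart straightens the basis fields to `∂/∂xᵢ`, so by linearity the forms `aᵢ` are the dual
  -- basis.
  refine ⟨_, _, rfl, hpq, φ, hφ, fun i => b.coord i, fun X v hv => ?_⟩
  have hX : T X = ∑ j, b.repr X j • T (b j) := by
    have h := congrArg (T ∘ₗ 𝔪.toSubmodule.subtype) (b.sum_repr X).symm
    simp only [map_sum, map_smul] at h
    exact h
  refine ⟨∑ j, b.repr X j • (T (b j)).value v, ?_, ?_⟩
  · rw [hX]
    exact FormalVectorField.HasValueAt.sum_smul _ _ fun j => (hφT v hv j).1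
  · rw [map_sum]
    simp only [map_smul, (hφT v hv _).2]
    ext i <;> simp [Prod.fst_sum, Prod.snd_sum, Pi.single_apply]
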